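/- Let $\eta=\operatorname{diag}(\eta_1,\dots,\eta_d)$ with $\eta_i\in\{1,-1\}$, let $\langle x,y\rangle=x^T\eta y$ on $\mathbb R^d$, and let $G_\eta(d)=\{O\in\mathbb R^{d\times d}: O^T\eta O=\eta\}$ act on matrices with $d$ rows by left multiplication. A vector $v\neq 0$ is called null if $\langle v,v\rangle=0$. Let $P\in\mathbb R^{d\times n}$ have no null columns, and let $\phi(P)=PM\in\mathbb R^{d\times d'}$ be formed by linearly independent columns of $P$, in their order, that span all columns of $P$. Let $\phi(P)=\hat Q\hat R$ be a generalized QR decomposition: there are $Q\in\mathbb R^{d\times d}$ with $Q^T\eta Q=D$ diagonal with entries $\pm1$, an upper triangular $R\in\mathbb R^{d\times d'}$ with positive diagonal entries such that $\phi(P)=QDR$, and a permutation matrix $S$ such that $\hat Q=QS\in G_\eta(d)$ and $\hat R=S^TDR$. Put $$\mathcal Q_P=\hat{\mathcal F}_\phi(\phi(P))=\{g\in G_\eta(d): g\hat R=\phi(P)\}=\hat Q\,\mathrm{Stab}_{G_\eta(d)}(\hat R).$$ A frame on $\mathbb R^{d\times n}$ is a map $\mathcal F$ to the non-empty subsets of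 $G_\eta(d)$ with $\mathcal F(gX)=g\mathcal F(X)$; it is minimal if for no $X$ there is a frame $\mathcal F'$ with $\mathcal F'(X)\subsetneq\mathcal F(X)$. A uniform probability measure on a set $\mathcal Q\subseteq G_\eta(d)$ is a Borel probability measure $\mu$ concentrated on $\mathcal Q$ such that $\mu(gX)=\mu(X)$ and $\mu(Xg)=\mu(X)$ whenever $X\subseteq\mathcal Q$ is Borel and the translate lies in $\mathcal Q$. Then $\mathcal Q_P$ is the value at $P$ of a minimal frame on $\mathbb R^{d\times n}$; it equals $\{\hat Q\}$ if $d'=d$; and it carries a uniform probability measure if and only if it is compact. Moreover, exactly $d'$ columns of $\hat Q$ are determined, i.e. shared by all elements of $\mathcal Q_P$. Let $Q_0\in\mathbb R^{d\times d}$ have these $d'$ columns in common with $\hat Q$ and its other $d-d'$ columns equal to $0$. Then for every function $\Phi:\mathbb R^{d\times n}\to\mathbb R^{d\times n}$ the frame average of $\Phi$ over $\mathcal Q_P$ is $Q_0\,\Phi(\hat Q^{-1}P)$, that is: (i) if $\mathcal Q_P$ is finite (in particular if $d'=d$), then $$\frac1{|\mathcal Q_P|}\sum_{g\in\mathcal Q_P}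 g\,\Phi(g^{-1}P)=Q_0\,\Phi(\hat Q^{-1}P);$$ (ii) for every uniform probability measure $\mu$ on $\mathcal Q_P$, the function $g\mapsto g\,\Phi(g^{-1}P)$ is integrable over $\mathcal Q_P$ and $$\int_{\mathcal Q_P} g\,\Phi(g^{-1}P)\,d\mu(g)=Q_0\,\Phi(\hat Q^{-1}P).$$ -/

import Mathlib

open MeasureTheory Matrix

noncomputable section

namespace MFA

/-- The pseudo-inner product `⟨x, y⟩ = xᵀ η y`, where `η` is given by its diagonal. -/
def pseudoInner {d : ℕ} (η : Fin d → ℝ) (x y : Fin d → ℝ) : ℝ :=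
  x ⬝ᵥ (diagonal η *ᵥ y)

/-- A nonzero vector is null if its pseudo-inner product with itself vanishes. -/
def IsNull {d : ℕ} (η : Fin d → ℝ) (x : Fin d → ℝ) : Prop :=
  x ≠ 0 ∧ pseudoInner η x x = 0

/-- The linear algebraic group `G_η(d) = {O | Oᵀ η O = η}`. -/
def Geta {d : ℕ} (η : Fin d → ℝ) : Subgroup (GL (Fin d) ℝ) where
  carrier := {g | (g : Matrix (Fin d) (Fin d) ℝ)ᵀ * diagonal η *
    (g : Matrix (Fin d) (Fin d) ℝ) = diagonal η}
  one_mem' := by simp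
  mul_mem' := by
    intro a b ha hb
    simp only [Set.mem_ofPred_eq, Units.val_mul, transpose_mul] at *
    calc _ = (b : Matrix (Fin d) (Fin d) ℝ)ᵀ * ((a : Matrix (Fin d) (Fin d) ℝ)ᵀ * diagonal η *
          (a : Matrix (Fin d) (Fin d) ℝ)) * (b : Matrix (Fin d) (Fin d) ℝ) := by
          simp only [Matrix.mul_assoc]
      _ = _ := by rw [ha, hb]
  inv_mem' := by
    intro a ha
    simp only [Set.mem_ofPred_eq] at *
    have h1 : (a : Matrix (Fin d) (Fin d) ℝ) * ((a⁻¹ : GL (Fin d) ℝ) : Matrix _ _ ℝ) = 1 :=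
      a.mul_inv
    have h2 : ((a⁻¹ : GL (Fin d) ℝ) : Matrix _ _ ℝ)ᵀ * (a : Matrix (Fin d) (Fin d) ℝ)ᵀ = 1 := by
      rw [← transpose_mul, h1, transpose_one]
    calc _ = ((a⁻¹ : GL (Fin d) ℝ) : Matrix _ _ ℝ)ᵀ * ((a : Matrix (Fin d) (Fin d) ℝ)ᵀ *
          diagonal η * (a : Matrix (Fin d) (Fin d) ℝ)) *
          ((a⁻¹ : GL (Fin d) ℝ) : Matrix _ _ ℝ) := by rw [ha]
      _ = (((a⁻¹ : GL (Fin d) ℝ) : Matrix _ _ ℝ)ᵀ * (a : Matrix (Fin d) (Fin d) ℝ)ᵀ) *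
          diagonal η * ((a : Matrix (Fin d) (Fin d) ℝ) *
          ((a⁻¹ : GL (Fin d) ℝ) : Matrix _ _ ℝ)) := by simp only [Matrix.mul_assoc]
      _ = _ := by rw [h1, h2, Matrix.one_mul, Matrix.mul_one]

/-- `G_η(d)` carries its Borel σ-algebra. -/
instance {d : ℕ} (η : Fin d → ℝ) : MeasurableSpace (Geta η) := borel _

instance {d : ℕ} (η : Fin d → ℝ) : BorelSpace (Geta η) := ⟨rfl⟩

/-- The defining representation; `g` acts on `d × m` matrices by `X ↦ rho g * X`. -/
def rho {d : ℕ} {η : Fin d → ℝ} (g : Geta η) : Matrix (Fin d) (Fin d) ℝ :=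
  ((g : GL (Fin d) ℝ) : Matrix (Fin d) (Fin d) ℝ)

/-- A `G_η(d)`-equivariant frame on `ℝ^{d × n}`. -/
def IsFrame {d : ℕ} (η : Fin d → ℝ) {n : ℕ}
    (F : Matrix (Fin d) (Fin n) ℝ → Set (Geta η)) : Prop :=
  (∀ P, (F P).Nonempty) ∧ ∀ (g : Geta η) P, F (rho g * P) = (fun h => g * h) '' F P

/-- A frame none of whose values properly contains the value of another frame. -/
def IsMinimalFrame {d : ℕ} (η : Fin d → ℝ) {n : ℕ}
    (F : Matrix (Fin d) (Fin n) ℝ → Set (Geta η)) : Prop :=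
  IsFrame η F ∧ ∀ P F', IsFrame η F' → ¬ F' P ⊂ F P

/-- The increasing family `sel` of column indices is a valid choice of columns of `P`: the chosen
columns are not null and linearly independent, and every non-null column is a combination of
them. -/
structure IsSelection {d n d' : ℕ} (η : Fin d → ℝ) (P : Matrix (Fin d) (Fin n) ℝ)
    (sel : Fin d' ↪o Fin n) : Prop where
  not_null : ∀ j, ¬ IsNull η (P.col (sel j))
  linearIndependent : LinearIndependent ℝ fun j => P.col (sel j)
  mem_span : ∀ j, ¬ IsNull η (P.col j) →
    P.col j ∈ Submodule.span ℝ (Set.range fun i => P.col (sel i))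

/-- The matrix `M` obtained from the identity by keeping only the selected columns. -/
def selMatrix {n d' : ℕ} (sel : Fin d' ↪o Fin n) : Matrix (Fin n) (Fin d') ℝ :=
  (1 : Matrix (Fin n) (Fin n) ℝ).submatrix id sel

/-- `φ(P) = P M`. -/
def phi {d n d' : ℕ} (sel : Fin d' ↪o Fin n) (P : Matrix (Fin d) (Fin n) ℝ) :
    Matrix (Fin d) (Fin d') ℝ :=
  P * selMatrix sel

/-- `A = Q̂ R̂` is a generalized QR decomposition: there are `Q` with `η`-orthonormal columns,
`Qᵀ η Q = D` with `D = diag(ε)`, `ε = ±1`, an upper triangular `R` with positive diagonal such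
that `A = Q D R`, and a permutation matrix `S` with `Q̂ = Q S ∈ G_η(d)` and `R̂ = Sᵀ D R`. -/
def IsGenQR {d m : ℕ} (η : Fin d → ℝ) (A : Matrix (Fin d) (Fin m) ℝ)
    (Qhat : Geta η) (Rhat : Matrix (Fin d) (Fin m) ℝ) : Prop :=
  ∃ (Q : Matrix (Fin d) (Fin d) ℝ) (ε : Fin d → ℝ) (R : Matrix (Fin d) (Fin m) ℝ)
    (σ : Equiv.Perm (Fin d)),
    (∀ i, ε i = 1 ∨ ε i = -1) ∧
    Qᵀ * diagonal η * Q = diagonal ε ∧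
    (∀ i j, j.val < i.val → R i j = 0) ∧
    (∀ i j, i.val = j.val → 0 < R i j) ∧
    A = Q * diagonal ε * R ∧
    rho Qhat = Q * σ.permMatrix ℝ ∧
    Rhat = (σ.permMatrix ℝ)ᵀ * diagonal ε * R

/-- The minimal frame at `A` given by the canonical form `Rhat` of `A`: the set of all `g` with
`g · Rhat = A`, that is, `h Stab(Rhat)` for any `h` with `h · Rhat = A`. -/
def qrFrame {d m : ℕ} (η : Fin d → ℝ) (A Rhat : Matrix (Fin d) (Fin m) ℝ) : Set (Geta η) :=
  {g | rho g * Rhat = A}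

/-- `μ` is a uniform probability measure on the subset `F` of the group: it is concentrated on
`F`, and translates of a Borel set inside `F` that stay inside `F` have the same measure. -/
structure IsUniformOn {d : ℕ} {η : Fin d → ℝ} (F : Set (Geta η)) (μ : Measure (Geta η)) :
    Prop where
  prob : IsProbabilityMeasure μ
  concentrated : μ Fᶜ = 0
  left_invariant : ∀ (g : Geta η) (X : Set (Geta η)), MeasurableSet X → X ⊆ F →
    (fun h => g * h) '' X ⊆ F → μ ((fun h => g * h) '' X) = μ X
  right_invariant : ∀ (g : Geta η) (X : Set (Geta η)), MeasurableSet X → X ⊆ F →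
    (fun h => h * g) '' X ⊆ F → μ ((fun h => h * g) '' X) = μ X

/-- The averaged quantity `ρ(g) Φ(ρ(g⁻¹) P)`. -/
def twist {d n : ℕ} {η : Fin d → ℝ}
    (Φ : Matrix (Fin d) (Fin n) ℝ → Matrix (Fin d) (Fin n) ℝ)
    (P : Matrix (Fin d) (Fin n) ℝ) (g : Geta η) : Matrix (Fin d) (Fin n) ℝ :=
  rho g * Φ (rho g⁻¹ * P)

/-- Frame averaging at `P` over a finite frame value `F`. -/
def finFrameAverage {d n : ℕ} {η : Fin d → ℝ} (F : Finset (Geta η))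
    (Φ : Matrix (Fin d) (Fin n) ℝ → Matrix (Fin d) (Fin n) ℝ)
    (P : Matrix (Fin d) (Fin n) ℝ) : Matrix (Fin d) (Fin n) ℝ :=
  (F.card : ℝ)⁻¹ • ∑ g ∈ F, twist Φ P g

/-- Frame averaging at `P` over the frame value `F` against `μ`, computed entry by entry. -/
def frameAverage {d n : ℕ} {η : Fin d → ℝ} (F : Set (Geta η)) (μ : Measure (Geta η))
    (Φ : Matrix (Fin d) (Fin n) ℝ → Matrix (Fin d) (Fin n) ℝ)
    (P : Matrix (Fin d) (Fin n) ℝ) : Matrix (Fin d) (Fin n) ℝ :=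
  Matrix.of fun i j => ∫ g in F, twist Φ P g i j ∂μ

end MFA

end

namespace MFA

/-! ### Topology of `Geta η` -/

section Topology

/-! Triangularity with positive diagonal shows that `N * Rhat = 0` forces exactly `d'` columns of
`N` to vanish. With `N = g - Qhat`, the frame is the left coset of `Qhat` under the subgroup fixing
the basis vectors indexed by a set `J` of size `d'` (`exists_determined_columns`). On this coset
`g⁻¹ P` is constantly `Qhat⁻¹ P`, because a matrix fixing `φ(P)` fixes every column of `P`
(`mul_phi_eq_iff`). So only the mean of `g` itself is needed.

As `η` is diagonal, each coordinate sign change lies in `Geta η`. For `k ∉ J` it lies in the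
subgroup and, acting on the right, negates column `k`. Hence that column is not shared, and its mean
is zero by invariance; columns in `J` are constant.

A uniform measure on the coset translates to a left-invariant probability on a closed subgroup,
which forces compactness; conversely, Haar measure of a compact subgroup is bi-invariant. Minimality
holds because each value of a frame at `X` is a union of right cosets of the stabilizer of `X`, and
the constructed value is just one. -/

theorem secondCountableTopology_matrix (d : ℕ) :
    SecondCountableTopology (Matrix (Fin d) (Fin d) ℝ) :=
  inferInstanceAs (SecondCountableTopology (Fin d → Fin d → ℝ))

theorem locallyCompactSpace_matrix (d : ℕ) :
    LocallyCompactSpace (Matrix (Fin d) (Fin d) ℝ) :=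
  inferInstanceAs (LocallyCompactSpace (Fin d → Fin d → ℝ))

instance secondCountableTopology_Geta {d : ℕ} (η : Fin d → ℝ) :
    SecondCountableTopology (Geta η) := by
  have := secondCountableTopology_matrix d
  have : SecondCountableTopology (Matrix (Fin d) (Fin d) ℝ)ᵐᵒᵖ :=
    MulOpposite.opHomeomorph.symm.secondCountableTopology
  have : SecondCountableTopology (GL (Fin d) ℝ) :=
    Units.isEmbedding_embedProduct.secondCountableTopology
  exact Topology.IsEmbedding.subtypeVal.secondCountableTopology

theorem continuous_rho {d : ℕ} {η : Fin d → ℝ} : Continuous (rho : Geta η → _) :=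
  Units.continuous_val.comp continuous_subtype_val

theorem isClosed_Geta {d : ℕ} (η : Fin d → ℝ) : IsClosed (Geta η : Set (GL (Fin d) ℝ)) := by
  have hv : Continuous fun g : GL (Fin d) ℝ => (g : Matrix (Fin d) (Fin d) ℝ) :=
    Units.continuous_val
  exact isClosed_eq ((hv.matrix_transpose.mul continuous_const).mul hv) continuous_const

instance locallyCompactSpace_Geta {d : ℕ} (η : Fin d → ℝ) : LocallyCompactSpace (Geta η) := by
  have := locallyCompactSpace_matrix d
  have : LocallyCompactSpace (GL (Fin d) ℝ) :=
    Units.isClosedEmbedding_embedProduct.locallyCompactSpace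
  exact (isClosed_Geta η).isClosedEmbedding_subtypeVal.locallyCompactSpace

end Topology

/-! ### Finite invariant measures and compactness -/

section InvariantMeasure

variable {G : Type*} [Group G] [TopologicalSpace G] [IsTopologicalGroup G] [T2Space G]
  [MeasurableSpace G] [BorelSpace G]

/-- A closed subgroup carrying a nonzero finite measure invariant under its left translations is
compact. -/
theorem isCompact_of_finite_invariant_measure [LocallyCompactSpace G] [SecondCountableTopology G]
    (K : Subgroup G) (hK : IsClosed (K : Set G))
    (μ : Measure G) [IsFiniteMeasure μ] (h0 : μ ≠ 0) (hc : μ (K : Set G)ᶜ = 0)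
    (hinv : ∀ k ∈ K, μ.map (fun g => k * g) = μ) : IsCompact (K : Set G) := by
  have : LocallyCompactSpace K := hK.isClosedEmbedding_subtypeVal.locallyCompactSpace
  have he : MeasurableEmbedding (Subtype.val : K → G) := .subtype_coe hK.measurableSet
  set ν : Measure K := μ.comap Subtype.val with hν
  have : IsFiniteMeasure ν := by
    refine ⟨?_⟩
    rw [hν, he.comap_apply]
    exact measure_lt_top _ _
  have hpos : ν Set.univ ≠ 0 := by
    rw [hν, he.comap_apply, Set.image_univ, Subtype.range_coe]
    intro h
    apply h0
    rw [← Measure.measure_univ_eq_zero, ← Set.union_compl_self (K : Set G)]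
    exact measure_union_null h hc
  have : NeZero ν := ⟨fun h => hpos (by simp [h])⟩
  have : ν.IsMulLeftInvariant := by
    refine ⟨fun k => ?_⟩
    ext s hs
    rw [Measure.map_apply (measurable_const_mul k) hs, hν, he.comap_apply, he.comap_apply]
    conv_rhs => rw [← hinv k k.2, Measure.map_apply (measurable_const_mul _)
      (he.measurableSet_image' hs)]
    congr 1
    ext x
    simp only [Set.mem_image, Set.mem_preimage]
    constructor
    · rintro ⟨y, hy, rfl⟩
      exact ⟨k * y, hy, rfl⟩
    · rintro ⟨y, hy, hxy⟩
      have hx : x = ↑(k⁻¹ * y) := by simp [hxy]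
      exact ⟨k⁻¹ * y, by simpa using hy, hx.symm⟩
  -- Second countability makes the finite measure `ν` regular. Being nonzero and left invariant, it
  -- then charges every nonempty open set, so noncompactness would make its total mass infinite.
  have : SecondCountableTopology K := Topology.IsEmbedding.subtypeVal.secondCountableTopology
  by_contra hcon
  have : NoncompactSpace K := by
    rw [← not_compactSpace_iff]
    exact fun h => hcon (isCompact_iff_compactSpace.2 h)
  exact measure_ne_top ν Set.univ (measure_univ_of_isMulLeftInvariant ν)

/-- A compact subgroup carries a probability measure invariant under its left and right
translations. -/
theorem exists_biinvariant_measure (K : Subgroup G) (hK : IsCompact (K : Set G)) :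
    ∃ μ : Measure G, IsProbabilityMeasure μ ∧ μ (K : Set G)ᶜ = 0 ∧
      (∀ k ∈ K, μ.map (fun g => k * g) = μ) ∧ ∀ k ∈ K, μ.map (fun g => g * k) = μ := by
  have : CompactSpace K := isCompact_iff_compactSpace.1 hK
  set ν : Measure K := Measure.haarMeasure ⊤ with hν
  have : IsProbabilityMeasure ν := ⟨by
    simpa using Measure.haarMeasure_self (G := K) (K₀ := ⊤)⟩
  have hm : Measurable (Subtype.val : K → G) := measurable_subtype_coe
  refine ⟨ν.map Subtype.val, Measure.isProbabilityMeasure_map hm.aemeasurable, ?_, ?_, ?_⟩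
  · rw [Measure.map_apply hm hK.isClosed.measurableSet.compl]
    convert measure_empty (μ := ν)
    ext x
    simp
  · intro k hk
    rw [Measure.map_map (measurable_const_mul k) hm]
    conv_rhs => rw [← map_mul_left_eq_self ν ⟨k, hk⟩,
      Measure.map_map hm (measurable_const_mul _)]
    rfl
  · intro k hk
    -- A right translate of Haar measure is again a left Haar probability, so uniqueness gives right
    -- invariance.
    have hr : ν.map (fun x => x * ⟨k, hk⟩) = ν := by
      have : IsProbabilityMeasure (ν.map (fun x => x * ⟨k, hk⟩)) :=
        Measure.isProbabilityMeasure_map (measurable_mul_const _).aemeasurable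
      exact Measure.isHaarMeasure_eq_of_isProbabilityMeasure _ _
    rw [Measure.map_map (measurable_mul_const k) hm]
    conv_rhs => rw [← hr, Measure.map_map hm (measurable_mul_const _)]
    rfl

end InvariantMeasure

end MFA

namespace MFA

variable {d : ℕ} {η : Fin d → ℝ}

theorem rho_mul (g h : Geta η) : rho (g * h) = rho g * rho h := rfl

theorem rho_one : rho (1 : Geta η) = 1 := rfl

theorem rho_inv_mul_self (g : Geta η) : rho g⁻¹ * rho g = 1 := by
  rw [← rho_mul, inv_mul_cancel, rho_one]

theorem rho_mul_rho_inv (g : Geta η) : rho g * rho g⁻¹ = 1 := by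
  rw [← rho_mul, mul_inv_cancel, rho_one]

theorem rho_inv (g : Geta η) : rho g⁻¹ = (rho g)⁻¹ :=
  (Matrix.inv_eq_left_inv (rho_inv_mul_self g)).symm

theorem rho_injective : Function.Injective (rho : Geta η → _) := fun _ _ h =>
  Subtype.ext (Units.ext h)

theorem rho_mul_cancel {m : ℕ} (g : Geta η) (X : Matrix (Fin d) (Fin m) ℝ) :
    rho g * (rho g⁻¹ * X) = X := by
  rw [← Matrix.mul_assoc, rho_mul_rho_inv, Matrix.one_mul]

theorem rho_inv_mul_cancel {m : ℕ} (g : Geta η) (X : Matrix (Fin d) (Fin m) ℝ) :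
    rho g⁻¹ * (rho g * X) = X := by
  rw [← Matrix.mul_assoc, rho_inv_mul_self, Matrix.one_mul]

/-! ### Minimal frames from orbit representatives -/

section MinimalFrame

variable {n : ℕ}

/-- A choice of orbit representatives that takes a prescribed value on one orbit. -/
theorem exists_orbit_representative (P : Matrix (Fin d) (Fin n) ℝ) (q : Geta η) :
    ∃ c : Matrix (Fin d) (Fin n) ℝ → Matrix (Fin d) (Fin n) ℝ,
      (∀ (g : Geta η) X, c (rho g * X) = c X) ∧ (∀ X, ∃ g : Geta η, rho g * c X = X) ∧
      c P = rho q⁻¹ * P := by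
  classical
  let s : Setoid (Matrix (Fin d) (Fin n) ℝ) :=
    { r := fun X Y => ∃ g : Geta η, rho g * X = Y
      iseqv :=
        { refl := fun X => ⟨1, by rw [rho_one, Matrix.one_mul]⟩
          symm := by
            rintro X _ ⟨g, rfl⟩
            exact ⟨g⁻¹, rho_inv_mul_cancel g X⟩
          trans := by
            rintro X _ _ ⟨g, rfl⟩ ⟨h, rfl⟩
            exact ⟨h * g, by rw [rho_mul, Matrix.mul_assoc]⟩ } }
  have hq : ∀ (g : Geta η) X, (Quotient.mk s (rho g * X)) = Quotient.mk s X := fun g X =>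
    Quotient.sound (s.iseqv.symm ⟨g, rfl⟩)
  refine ⟨fun X => if Quotient.mk s X = Quotient.mk s P then rho q⁻¹ * P
    else (Quotient.mk s X).out, fun g X => by simp only [hq], fun X => ?_, by simp⟩
  beta_reduce
  by_cases h : Quotient.mk s X = Quotient.mk s P
  · obtain ⟨g, hg⟩ : ∃ g : Geta η, rho g * P = X := Quotient.exact h.symm
    refine ⟨g * q, ?_⟩
    rw [if_pos h, rho_mul, Matrix.mul_assoc, rho_mul_cancel, hg]
  · rw [if_neg h]
    exact Quotient.exact (Quotient.out_eq (Quotient.mk s X))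

theorem exists_isMinimalFrame (P : Matrix (Fin d) (Fin n) ℝ) (q : Geta η) :
    ∃ F, IsMinimalFrame η F ∧ F P = {g : Geta η | rho g * (rho q⁻¹ * P) = P} := by
  obtain ⟨c, hinv, horb, hcP⟩ := exists_orbit_representative P q
  refine ⟨fun X => {g | rho g * c X = X}, ⟨⟨horb, fun g X => ?_⟩, ?_⟩, ?_⟩
  · ext h
    simp only [hinv, Set.mem_ofPred_eq, Set.mem_image]
    constructor
    · intro hh
      exact ⟨g⁻¹ * h, by rw [rho_mul, Matrix.mul_assoc, hh, rho_inv_mul_cancel], by simp⟩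
    · rintro ⟨k, hk, rfl⟩
      rw [rho_mul, Matrix.mul_assoc, hk]
  · rintro X F' ⟨hne, heq⟩ ⟨hsub, hnot⟩
    obtain ⟨h, hh⟩ := hne X
    have hhX : rho h * c X = X := hsub hh
    refine hnot fun g (hg : rho g * c X = X) => ?_
    -- Two elements of the constructed value differ by a stabilizer element of `X`, and equivariance
    -- makes `F' X` stable under these; one point of `F' X` thus yields all the others.
    have hstab : rho (g * h⁻¹) * X = X := by
      conv_lhs => rw [← hhX, rho_mul, Matrix.mul_assoc, rho_inv_mul_cancel, hg]
    rw [← hstab, heq]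
    exact ⟨h, hh, by simp⟩
  · simp only [hcP]

end MinimalFrame

/-! ### Columns determined by the QR decomposition -/

section Columns

theorem phi_apply {n d' : ℕ} (sel : Fin d' ↪o Fin n) (P : Matrix (Fin d) (Fin n) ℝ) (i : Fin d)
    (j : Fin d') : phi sel P i j = P i (sel j) := by
  simp [phi, selMatrix, Matrix.mul_apply, Matrix.one_apply]

/-- A matrix fixes `φ(P)` if and only if it fixes `P`. -/
theorem mul_phi_eq_iff {n d' : ℕ} {P : Matrix (Fin d) (Fin n) ℝ}
    (hP : ∀ j, ¬ IsNull η (P.col j)) {sel : Fin d' ↪o Fin n} (hsel : IsSelection η P sel)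
    (T : Matrix (Fin d) (Fin d) ℝ) : T * phi sel P = phi sel P ↔ T * P = P := by
  constructor
  · intro h
    have key : ∀ j, T *ᵥ P.col j = P.col j := by
      intro j
      -- The vectors fixed by `T` form a subspace, so fixing the selected columns means fixing their
      -- span.
      have hle : Submodule.span ℝ (Set.range fun i => P.col (sel i)) ≤
          LinearMap.eqLocus T.mulVecLin LinearMap.id := by
        rw [Submodule.span_le]
        rintro _ ⟨i, rfl⟩
        change T *ᵥ P.col (sel i) = P.col (sel i)
        ext a
        have := congrFun (congrFun h a) i
        simp only [Matrix.mul_apply, phi_apply] at this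
        exact this
      exact hle (hsel.mem_span j (hP j))
    ext i j
    exact congrFun (key j) i
  · intro h
    rw [phi, ← Matrix.mul_assoc, h]

/-- For `R` upper triangular with nonzero diagonal, a matrix annihilates `Sᵀ D R` if and only if
it annihilates the basis vectors that `S` assigns to the first columns. -/
theorem mul_permuted_triangular_eq_zero_iff {m : ℕ} {ε : Fin d → ℝ}
    (hε : ∀ i, ε i = 1 ∨ ε i = -1) {R : Matrix (Fin d) (Fin m) ℝ}
    (hup : ∀ i j, j.val < i.val → R i j = 0) (hdiag : ∀ i j, i.val = j.val → 0 < R i j)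
    (σ : Equiv.Perm (Fin d)) (N : Matrix (Fin d) (Fin d) ℝ) :
    N * ((σ.permMatrix ℝ)ᵀ * diagonal ε * R) = 0 ↔
      ∀ l : Fin d, l.val < m → N.col (σ l) = 0 := by
  have hentry : ∀ i j, (N * ((σ.permMatrix ℝ)ᵀ * diagonal ε * R)) i j =
      ∑ l, N i (σ l) * (ε l * R l j) := by
    intro i j
    have hS : ∀ l, ((σ.permMatrix ℝ)ᵀ * diagonal ε * R) (σ l) j = ε l * R l j := by
      intro l
      rw [Matrix.mul_assoc, Matrix.mul_apply, Finset.sum_eq_single l]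
      · simp [Equiv.Perm.permMatrix, PEquiv.toMatrix_apply, Matrix.diagonal_mul]
      · intro b _ hb
        simp [Equiv.Perm.permMatrix, PEquiv.toMatrix_apply, hb]
      · simp
    rw [Matrix.mul_apply, ← Equiv.sum_comp σ]
    simp only [hS]
  constructor
  · intro h
    -- Forward substitution: in column `t` of the product, earlier terms vanish by induction and
    -- later ones by triangularity. What remains is `N i (σ l)` times a nonzero diagonal entry.
    have key : ∀ t : ℕ, ∀ l : Fin d, l.val = t → t < m → N.col (σ l) = 0 := by
      intro t
      induction t using Nat.strong_induction_on with
      | _ t ih =>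
        intro l hl ht
        ext i
        have h1 : ∑ b, N i (σ b) * (ε b * R b ⟨t, ht⟩) = 0 := by
          rw [← hentry, h]; rfl
        rw [Finset.sum_eq_single l] at h1
        · have hR := hdiag l ⟨t, ht⟩ hl
          have he : ε l ≠ 0 := by rcases hε l with h | h <;> simp [h]
          exact (mul_eq_zero.1 h1).resolve_right (mul_ne_zero he hR.ne')
        · intro b _ hb
          rcases lt_or_gt_of_ne (fun hv => hb (Fin.ext hv) : b.val ≠ l.val) with hlt | hgt
          · have := congrFun (ih b.val (hl ▸ hlt) b rfl (by omega)) i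
            rw [show N i (σ b) = 0 from this, zero_mul]
          · rw [hup b ⟨t, ht⟩ (hl ▸ hgt), mul_zero, mul_zero]
        · simp
    exact fun l hl => key l.val l rfl hl
  · intro h
    ext i j
    rw [hentry]
    refine Finset.sum_eq_zero fun l _ => ?_
    by_cases hl : l.val < m
    · rw [show N i (σ l) = 0 from congrFun (h l hl) i, zero_mul]
    -- Rows of `R` with index at least `m` lie wholly below the diagonal.
    · rw [hup l j (by omega), mul_zero, mul_zero]

/-- The frame of a generalized QR decomposition of a matrix with `m ≤ d` columns consists of the
group elements that share `m` fixed columns with the orthogonal factor. -/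
theorem exists_determined_columns {m : ℕ} (hm : m ≤ d) {A Rhat : Matrix (Fin d) (Fin m) ℝ}
    {q : Geta η} (hQR : IsGenQR η A q Rhat) :
    A = rho q * Rhat ∧ ∃ J : Finset (Fin d), J.card = m ∧
      qrFrame η A Rhat = {g | ∀ k ∈ J, (rho g).col k = (rho q).col k} := by
  obtain ⟨Q, ε, R, σ, hε, -, hup, hdiag, hA, hq, rfl⟩ := hQR
  have hAq : A = rho q * ((σ.permMatrix ℝ)ᵀ * diagonal ε * R) := by
    have hS : σ.permMatrix ℝ * (σ.permMatrix ℝ)ᵀ = 1 := by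
      rw [Matrix.transpose_permMatrix, ← Matrix.permMatrix_mul]
      simp
    calc A = Q * (σ.permMatrix ℝ * (σ.permMatrix ℝ)ᵀ) * diagonal ε * R := by
          rw [hS, Matrix.mul_one, hA]
      _ = _ := by rw [hq]; simp only [Matrix.mul_assoc]
  refine ⟨hAq, (Finset.univ.filter fun l : Fin d => l.val < m).map σ.toEmbedding, ?_, ?_⟩
  · rw [Finset.card_map, Fin.card_filter_val_lt, min_eq_right hm]
  · ext g
    simp only [qrFrame, Set.mem_ofPred_eq, Finset.mem_map, Finset.mem_filter, Finset.mem_univ,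
      true_and, Equiv.coe_toEmbedding, forall_exists_index, and_imp, forall_apply_eq_imp_iff₂]
    -- The frame condition becomes `(rho g - rho q) * Rhat = 0`.
    rw [hAq, ← sub_eq_zero, ← Matrix.sub_mul,
      mul_permuted_triangular_eq_zero_iff hε hup hdiag]
    refine forall₂_congr fun l _ => ?_
    rw [← sub_eq_zero (a := (rho g).col (σ l))]
    rfl

end Columns

end MFA

/-! ### Column stabilizers and reflections -/

namespace MFA

variable {d : ℕ} {η : Fin d → ℝ}

/-- The elements of the group whose columns with index in `J` are those of the identity. -/
def columnStabilizer (η : Fin d → ℝ) (J : Finset (Fin d)) : Subgroup (Geta η) where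
  carrier := {g | ∀ k ∈ J, (rho g).col k = (rho (1 : Geta η)).col k}
  one_mem' := fun _ _ => rfl
  mul_mem' := by
    intro a b ha hb k hk
    have h : (rho (a * b)).col k = rho a *ᵥ (rho b).col k := rfl
    have h1 : rho a *ᵥ (rho (1 : Geta η)).col k = (rho (a * 1)).col k := rfl
    rw [h, hb k hk, h1, mul_one, ha k hk]
  inv_mem' := by
    intro a ha k hk
    have h : (rho (a⁻¹ * a)).col k = rho a⁻¹ *ᵥ (rho a).col k := rfl
    rw [ha k hk, inv_mul_cancel] at h
    have h1 : rho a⁻¹ *ᵥ (rho (1 : Geta η)).col k = (rho (a⁻¹ * 1)).col k := rfl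
    rw [h, h1, mul_one]

/-- Multiplying by the invertible `rho q` moves between the two conditions. This turns the frame
into a left coset, the form used for averaging. -/
theorem inv_mul_mem_columnStabilizer {J : Finset (Fin d)} {q g : Geta η} :
    q⁻¹ * g ∈ columnStabilizer η J ↔ ∀ k ∈ J, (rho g).col k = (rho q).col k := by
  refine forall₂_congr fun k _ => ?_
  have h1 : (rho (q⁻¹ * g)).col k = rho q⁻¹ *ᵥ (rho g).col k := rfl
  have h2 : (rho (1 : Geta η)).col k = rho q⁻¹ *ᵥ (rho q).col k := by
    rw [← inv_mul_cancel q]; rfl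
  rw [h1, h2]
  refine ⟨fun h => ?_, fun h => by rw [h]⟩
  have := congrArg (fun v => rho q *ᵥ v) h
  simpa [Matrix.mulVec_mulVec, rho_mul_rho_inv] using this

theorem isClosed_columnStabilizer (J : Finset (Fin d)) :
    IsClosed (columnStabilizer η J : Set (Geta η)) := by
  have : (columnStabilizer η J : Set (Geta η)) =
      ⋂ k ∈ J, {g | (rho g).col k = (rho (1 : Geta η)).col k} := by
    ext g
    simp [columnStabilizer]
  rw [this]
  refine isClosed_biInter fun k _ => isClosed_eq ?_ continuous_const
  exact continuous_pi fun i => continuous_rho.matrix_elem i k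

/-- The reflection that changes the sign of the `k`-th coordinate. -/
theorem exists_reflection (η : Fin d → ℝ) (k : Fin d) :
    ∃ s : Geta η, rho s = diagonal (Function.update 1 k (-1)) := by
  have hsq : diagonal (Function.update (1 : Fin d → ℝ) k (-1)) *
      diagonal (Function.update (1 : Fin d → ℝ) k (-1)) = 1 := by
    rw [Matrix.diagonal_mul_diagonal, ← Matrix.diagonal_one]
    congr 1
    ext i
    by_cases h : i = k
    · subst h; simp
    · simp [h]
  refine ⟨⟨⟨_, _, hsq, hsq⟩, ?_⟩, rfl⟩
  change (diagonal (Function.update (1 : Fin d → ℝ) k (-1)))ᵀ * diagonal η *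
      diagonal (Function.update (1 : Fin d → ℝ) k (-1)) = diagonal η
  -- All factors are diagonal, so the two sign changes cancel.
  rw [Matrix.diagonal_transpose, Matrix.diagonal_mul_diagonal, Matrix.diagonal_mul_diagonal]
  congr 1
  ext i
  by_cases h : i = k
  · subst h; simp
  · simp [h]

/-- For `k ∉ J` some element of the column stabilizer changes the sign of the `k`-th column. -/
theorem exists_mem_columnStabilizer_neg_col {J : Finset (Fin d)} {k : Fin d} (hk : k ∉ J) :
    ∃ s ∈ columnStabilizer η J, ∀ (g : Geta η) i, rho (g * s) i k = -rho g i k := by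
  obtain ⟨s, hs⟩ := exists_reflection η k
  refine ⟨s, fun l hl => ?_, fun g i => ?_⟩
  · have hlk : l ≠ k := fun h => hk (h ▸ hl)
    ext i
    rw [hs, rho_one]
    by_cases h : i = l
    · subst h; simp [hlk]
    · simp [h]
  · rw [rho_mul, hs, Matrix.mul_diagonal]
    simp

/-- For `k ∉ J` the coset contains `q` with column `k` negated. A shared column would equal its own
negative, hence vanish, contradicting invertibility. -/
theorem mem_iff_forall_col_eq {J : Finset (Fin d)} (q : Geta η) (k : Fin d) :
    k ∈ J ↔ ∀ g ∈ {g : Geta η | ∀ l ∈ J, (rho g).col l = (rho q).col l},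
      (rho g).col k = (rho q).col k := by
  refine ⟨fun hk g hg => hg k hk, fun h => ?_⟩
  by_contra hk
  obtain ⟨s, hs, hneg⟩ := exists_mem_columnStabilizer_neg_col (η := η) hk
  have hcol := h (q * s) (inv_mul_mem_columnStabilizer.1 (by simpa using hs))
  have h0 : (rho q).col k = 0 := by
    ext i
    have h1 : rho (q * s) i k = rho q i k := congrFun hcol i
    rw [hneg] at h1
    change rho q i k = 0
    linarith
  have h1 : (rho q⁻¹ * rho q) k k = 0 := by
    rw [Matrix.mul_apply]
    refine Finset.sum_eq_zero fun i _ => ?_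
    rw [show rho q i k = 0 from congrFun h0 i, mul_zero]
  rw [rho_inv_mul_self, Matrix.one_apply_eq] at h1
  exact one_ne_zero h1

/-! ### Uniform measures on cosets -/

section Uniform

/-- Uniformity only speaks of sets that stay inside `F`. As `f` maps `F` onto itself and `Fᶜ` is
null, testing it on `f ⁻¹' X ∩ F`, with image `X ∩ F`, gives invariance under `f` for all measurable
sets. -/
theorem map_eq_self_of_image {α : Type*} [MeasurableSpace α] {μ : Measure α} {F : Set α}
    (hF : MeasurableSet F) (hc : μ Fᶜ = 0) {f : α → α} (hf : Measurable f)
    (hmaps : Set.MapsTo f F F) (hsurj : Set.SurjOn f F F)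
    (h : ∀ X, MeasurableSet X → X ⊆ F → f '' X ⊆ F → μ (f '' X) = μ X) : μ.map f = μ := by
  have hnull : ∀ s, μ (s ∩ F) = μ s := fun s =>
    measure_inter_conull hc
  ext X hX
  rw [Measure.map_apply hf hX, ← hnull (f ⁻¹' X), ← hnull X,
    ← h _ ((hf hX).inter hF) Set.inter_subset_right]
  · congr 1
    ext y
    constructor
    · rintro ⟨x, ⟨hxX, hxF⟩, rfl⟩
      exact ⟨hxX, hmaps hxF⟩
    · rintro ⟨hyX, hyF⟩
      obtain ⟨x, hx, rfl⟩ := hsurj hyF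
      exact ⟨x, ⟨hyX, hx⟩, rfl⟩
  · rintro _ ⟨x, hx, rfl⟩
    exact hmaps hx.2

variable {K : Subgroup (Geta η)} {q : Geta η} {μ : Measure (Geta η)}

theorem isClosed_coset (hK : IsClosed (K : Set (Geta η))) (q : Geta η) :
    IsClosed {g : Geta η | q⁻¹ * g ∈ K} :=
  hK.preimage (continuous_const_mul q⁻¹)

theorem IsUniformOn.map_mul_right (hK : IsClosed (K : Set (Geta η)))
    (hμ : IsUniformOn {g | q⁻¹ * g ∈ K} μ) {k : Geta η} (hk : k ∈ K) :
    μ.map (fun g => g * k) = μ := by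
  refine map_eq_self_of_image (isClosed_coset hK q).measurableSet hμ.concentrated
    (measurable_mul_const k) (fun g hg => ?_) (fun g hg => ⟨g * k⁻¹, ?_, by simp⟩)
    (hμ.right_invariant k)
  · simpa only [Set.mem_ofPred_eq, mul_assoc] using K.mul_mem hg hk
  · simpa only [Set.mem_ofPred_eq, mul_assoc] using K.mul_mem hg (K.inv_mem hk)

/-- The left translations preserving `qK` come from the conjugate `q K q⁻¹`. -/
theorem IsUniformOn.map_mul_left (hK : IsClosed (K : Set (Geta η)))
    (hμ : IsUniformOn {g | q⁻¹ * g ∈ K} μ) {k : Geta η} (hk : k ∈ K) :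
    μ.map (fun g => q * k * q⁻¹ * g) = μ := by
  refine map_eq_self_of_image (isClosed_coset hK q).measurableSet hμ.concentrated
    (measurable_const_mul _) (fun g hg => ?_) (fun g hg => ⟨q * k⁻¹ * q⁻¹ * g, ?_, by group⟩)
    (hμ.left_invariant _)
  · have := K.mul_mem hk hg
    simpa only [Set.mem_ofPred_eq, mul_assoc, inv_mul_cancel_left] using this
  · have := K.mul_mem (K.inv_mem hk) hg
    simpa only [Set.mem_ofPred_eq, mul_assoc, inv_mul_cancel_left] using this

theorem isCompact_coset_iff :
    IsCompact {g : Geta η | q⁻¹ * g ∈ K} ↔ IsCompact (K : Set (Geta η)) :=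
  (Homeomorph.mulLeft q⁻¹).isCompact_preimage (s := (K : Set (Geta η)))

/-- Translation by `q⁻¹` moves the measure to `K` and turns invariance under `q K q⁻¹` into left
invariance under `K`. -/
theorem IsUniformOn.isCompact (hK : IsClosed (K : Set (Geta η)))
    (hμ : IsUniformOn {g | q⁻¹ * g ∈ K} μ) : IsCompact {g : Geta η | q⁻¹ * g ∈ K} := by
  have := hμ.prob
  have hm : Measurable fun g : Geta η => q⁻¹ * g := measurable_const_mul _
  have := Measure.isProbabilityMeasure_map (μ := μ) hm.aemeasurable
  refine isCompact_coset_iff.2 (isCompact_of_finite_invariant_measure K hK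
    (μ.map fun g => q⁻¹ * g) (IsProbabilityMeasure.ne_zero _) ?_ fun k hk => ?_)
  · rw [Measure.map_apply hm hK.measurableSet.compl]
    exact hμ.concentrated
  · conv_rhs => rw [← hμ.map_mul_left hK hk]
    rw [Measure.map_map (measurable_const_mul _) hm, Measure.map_map hm (measurable_const_mul _)]
    congr 1
    ext1 g
    simp [mul_assoc]

/-- The measure is the translate by `q` of the bi-invariant probability on `K`. If a translation
keeps even one point of `qK` inside `qK`, the translating element lies in `q K q⁻¹` (left) or `K`
(right), so invariance on `K` applies. -/
theorem exists_isUniformOn_of_isCompact (hc : IsCompact {g : Geta η | q⁻¹ * g ∈ K}) :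
    ∃ μ, IsUniformOn {g | q⁻¹ * g ∈ K} μ := by
  have hK : IsCompact (K : Set (Geta η)) := isCompact_coset_iff.1 hc
  obtain ⟨μ, hprob, hconc, hleft, hright⟩ := exists_biinvariant_measure K hK
  have hm : Measurable fun g : Geta η => q * g := measurable_const_mul _
  refine ⟨μ.map fun g => q * g, Measure.isProbabilityMeasure_map hm.aemeasurable, ?_, ?_, ?_⟩
  · rw [Measure.map_apply hm hc.isClosed.measurableSet.compl]
    simpa using hconc
  · intro g X _ hX hgX
    obtain rfl | ⟨x, hx⟩ := X.eq_empty_or_nonempty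
    · simp
    have hk : q⁻¹ * g * q ∈ K := by
      have h1 : q⁻¹ * (g * x) ∈ K := hgX ⟨x, hx, rfl⟩
      have h2 : q⁻¹ * x ∈ K := hX hx
      have h3 := K.mul_mem h1 (K.inv_mem h2)
      simpa [mul_assoc] using h3
    have hmap : (μ.map fun g => q * g).map (MeasurableEquiv.mulLeft g) =
        μ.map fun g => q * g := by
      conv_rhs => rw [← hleft _ hk]
      rw [Measure.map_map hm (measurable_const_mul _),
        Measure.map_map (MeasurableEquiv.measurable _) hm]
      congr 1
      ext1 h
      simp [mul_assoc]
    conv_lhs => rw [← hmap, MeasurableEquiv.map_apply]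
    congr 1
    exact Set.preimage_image_eq X (mul_right_injective g)
  · intro g X _ hX hgX
    obtain rfl | ⟨x, hx⟩ := X.eq_empty_or_nonempty
    · simp
    have hk : g ∈ K := by
      have h1 : q⁻¹ * (x * g) ∈ K := hgX ⟨x, hx, rfl⟩
      have h2 : q⁻¹ * x ∈ K := hX hx
      have h3 := K.mul_mem (K.inv_mem h2) h1
      simpa [mul_assoc] using h3
    have hmap : (μ.map fun g => q * g).map (MeasurableEquiv.mulRight g) =
        μ.map fun g => q * g := by
      conv_rhs => rw [← hright _ hk]
      rw [Measure.map_map hm (measurable_mul_const _),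
        Measure.map_map (MeasurableEquiv.measurable _) hm]
      congr 1
      ext1 h
      simp [mul_assoc]
    conv_lhs => rw [← hmap, MeasurableEquiv.map_apply]
    congr 1
    exact Set.preimage_image_eq X (mul_left_injective g)

end Uniform

/-! ### Means of the matrix entries -/

section Average

variable {J : Finset (Fin d)} {q : Geta η}

/-- The mean over a finite coset of the column stabilizer keeps the columns in `J` and kills the
others. -/
theorem mean_entry_of_finite
    (hF : {g : Geta η | q⁻¹ * g ∈ columnStabilizer η J}.Finite) (i k : Fin d) :
    (hF.toFinset.card : ℝ)⁻¹ * ∑ g ∈ hF.toFinset, rho g i k =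
      if k ∈ J then rho q i k else 0 := by
  split_ifs with hk
  · have hcard : (hF.toFinset.card : ℝ) ≠ 0 := by
      rw [Nat.cast_ne_zero, Finset.card_ne_zero]
      exact ⟨q, by simp [(columnStabilizer η J).one_mem]⟩
    rw [Finset.sum_congr rfl (g := fun _ => rho q i k), Finset.sum_const, nsmul_eq_mul,
      inv_mul_cancel_left₀ hcard]
    intro g hg
    exact congrFun (inv_mul_mem_columnStabilizer.1 (hF.mem_toFinset.1 hg) k hk) i
  · obtain ⟨s, hs, hneg⟩ := exists_mem_columnStabilizer_neg_col (η := η) hk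
    -- Right multiplication by `s` permutes the coset and negates column `k`, so the sum equals its
    -- own negative.
    have h : ∑ g ∈ hF.toFinset, rho g i k = ∑ g ∈ hF.toFinset, rho (g * s) i k := by
      symm
      refine Finset.sum_equiv (Equiv.mulRight s) (fun g => ?_) (fun g _ => rfl)
      simp only [Set.Finite.mem_toFinset, Set.mem_ofPred_eq, Equiv.coe_mulRight, ← mul_assoc]
      exact ((columnStabilizer η J).mul_mem_cancel_right hs).symm
    simp only [hneg, Finset.sum_neg_distrib] at h
    rw [show ∑ g ∈ hF.toFinset, rho g i k = 0 by linarith, mul_zero]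

/-- The mean against a uniform probability measure on a coset of the column stabilizer keeps the
columns in `J` and kills the others. -/
theorem IsUniformOn.mean_entry {μ : Measure (Geta η)}
    (hμ : IsUniformOn {g | q⁻¹ * g ∈ columnStabilizer η J} μ) (i k : Fin d) :
    ∫ g in {g | q⁻¹ * g ∈ columnStabilizer η J}, rho g i k ∂μ =
      if k ∈ J then rho q i k else 0 := by
  have := hμ.prob
  have hcl := isClosed_columnStabilizer (η := η) J
  have hmeas := (isClosed_coset hcl q).measurableSet
  have hres : μ.restrict {g | q⁻¹ * g ∈ columnStabilizer η J} = μ :=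
    Measure.restrict_eq_self_of_ae_mem hμ.concentrated
  split_ifs with hk
  · have hcongr : Set.EqOn (fun g => rho g i k) (fun _ => rho q i k)
        {g | q⁻¹ * g ∈ columnStabilizer η J} := fun g hg =>
      congrFun (inv_mul_mem_columnStabilizer.1 hg k hk) i
    rw [setIntegral_congr_fun hmeas hcongr, hres]
    simp
  · obtain ⟨s, hs, hneg⟩ := exists_mem_columnStabilizer_neg_col (η := η) hk
    -- The same cancellation; the change of variables and `integral_neg` need no integrability.
    have h : ∫ g, rho g i k ∂μ = ∫ g, rho (g * s) i k ∂μ := by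
      conv_lhs => rw [← hμ.map_mul_right hcl hs]
      exact integral_map (measurable_mul_const s).aemeasurable
        (continuous_rho.matrix_elem i k).aestronglyMeasurable
    simp only [hneg, integral_neg] at h
    rw [hres]
    linarith

/-- Although `Geta η` may be noncompact, a uniform measure forces its coset to be compact, so
continuous entries are integrable there. -/
theorem IsUniformOn.integrableOn_entry {μ : Measure (Geta η)}
    (hμ : IsUniformOn {g | q⁻¹ * g ∈ columnStabilizer η J} μ) (i k : Fin d) :
    IntegrableOn (fun g => rho g i k) {g | q⁻¹ * g ∈ columnStabilizer η J} μ := by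
  have := hμ.prob
  exact (continuous_rho.matrix_elem i k).continuousOn.integrableOn_compact
    (hμ.isCompact (isClosed_columnStabilizer J))

end Average

end MFA

/-! ### The frame average -/

theorem mainTheorem3 {d n d' : ℕ} (η : Fin d → ℝ) (hη : ∀ i, η i = 1 ∨ η i = -1)
    (P : Matrix (Fin d) (Fin n) ℝ) (hP : ∀ j, ¬ MFA.IsNull η (P.col j))
    (sel : Fin d' ↪o Fin n) (hsel : MFA.IsSelection η P sel)
    (Qhat : MFA.Geta η) (Rhat : Matrix (Fin d) (Fin d') ℝ)
    (hQR : MFA.IsGenQR η (MFA.phi sel P) Qhat Rhat) :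
    -- the frame is the value at `P` of a minimal frame on `ℝ^{d × n}`
    (∃ F : Matrix (Fin d) (Fin n) ℝ → Set (MFA.Geta η),
      MFA.IsMinimalFrame η F ∧ F P = MFA.qrFrame η (MFA.phi sel P) Rhat) ∧
    -- it is a single point if `d' = d`
    (d' = d → MFA.qrFrame η (MFA.phi sel P) Rhat = {Qhat}) ∧
    -- it carries a uniform probability measure exactly if it is compact
    ((∃ μ, MFA.IsUniformOn (MFA.qrFrame η (MFA.phi sel P) Rhat) μ) ↔
      IsCompact (MFA.qrFrame η (MFA.phi sel P) Rhat)) ∧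
    ∃ (Q₀ : Matrix (Fin d) (Fin d) ℝ) (J : Finset (Fin d)),
      J.card = d' ∧
      -- `J` indexes the determined columns, those shared by all elements of the frame
      (∀ k, k ∈ J ↔ ∀ g ∈ MFA.qrFrame η (MFA.phi sel P) Rhat,
        (MFA.rho g).col k = (MFA.rho Qhat).col k) ∧
      (∀ k ∈ J, Q₀.col k = (MFA.rho Qhat).col k) ∧
      (∀ k ∉ J, Q₀.col k = 0) ∧
      ∀ Φ : Matrix (Fin d) (Fin n) ℝ → Matrix (Fin d) (Fin n) ℝ,
        -- average over a finite frame
        (∀ hF : (MFA.qrFrame η (MFA.phi sel P) Rhat).Finite,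
          MFA.finFrameAverage hF.toFinset Φ P = Q₀ * Φ ((MFA.rho Qhat)⁻¹ * P)) ∧
        -- integral average
        ∀ μ, MFA.IsUniformOn (MFA.qrFrame η (MFA.phi sel P) Rhat) μ →
          (∀ i j, IntegrableOn (fun g => MFA.twist Φ P g i j)
            (MFA.qrFrame η (MFA.phi sel P) Rhat) μ) ∧
          MFA.frameAverage (MFA.qrFrame η (MFA.phi sel P) Rhat) μ Φ P =
            Q₀ * Φ ((MFA.rho Qhat)⁻¹ * P) := by
  have hd : d' ≤ d := by
    simpa using hsel.linearIndependent.fintype_card_le_finrank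
  obtain ⟨hA, J, hJcard, hJ⟩ := MFA.exists_determined_columns hd hQR
  have hcoset : MFA.qrFrame η (MFA.phi sel P) Rhat =
      {g | Qhat⁻¹ * g ∈ MFA.columnStabilizer η J} := by
    rw [hJ]
    ext g
    exact MFA.inv_mul_mem_columnStabilizer.symm
  -- Since `Rhat` is `Qhat⁻¹ φ(P)`, membership says that `g Qhat⁻¹` fixes `φ(P)`, equivalently `P`.
  have hfix : MFA.qrFrame η (MFA.phi sel P) Rhat =
      {g | MFA.rho g * (MFA.rho Qhat⁻¹ * P) = P} := by
    ext g
    change MFA.rho g * Rhat = MFA.phi sel P ↔ MFA.rho g * (MFA.rho Qhat⁻¹ * P) = P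
    rw [← Matrix.mul_assoc, ← MFA.mul_phi_eq_iff hP hsel, Matrix.mul_assoc]
    conv_rhs => lhs; rw [hA, MFA.rho_inv_mul_cancel]
  have hcl := MFA.isClosed_columnStabilizer (η := η) J
  -- The argument of `Φ` is constant on the frame, so the average is linear in the entries of `g`
  -- and no regularity of `Φ` is needed.
  have hentry : ∀ (Φ : Matrix (Fin d) (Fin n) ℝ → Matrix (Fin d) (Fin n) ℝ),
      ∀ g ∈ MFA.qrFrame η (MFA.phi sel P) Rhat, ∀ i j, MFA.twist Φ P g i j =
        ∑ k, MFA.rho g i k * Φ ((MFA.rho Qhat)⁻¹ * P) k j := by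
    intro Φ g hg i j
    rw [hfix] at hg
    have hg' : MFA.rho g⁻¹ * P = (MFA.rho Qhat)⁻¹ * P := by
      rw [← MFA.rho_inv]
      conv_lhs => rw [← show MFA.rho g * (MFA.rho Qhat⁻¹ * P) = P from hg]
      rw [MFA.rho_inv_mul_cancel]
    rw [MFA.twist, hg', Matrix.mul_apply]
  refine ⟨?_, ?_, ⟨?_, ?_⟩, Matrix.of fun i k => if k ∈ J then MFA.rho Qhat i k else 0, J,
    hJcard, ?_, ?_, ?_, fun Φ => ⟨?_, ?_⟩⟩
  · rw [hfix]
    exact MFA.exists_isMinimalFrame P Qhat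
  · rintro rfl
    have hJu : J = Finset.univ := Finset.eq_univ_of_card J (by simpa using hJcard)
    rw [hJ]
    ext g
    simp only [hJu, Finset.mem_univ, true_imp_iff, Set.mem_ofPred_eq, Set.mem_singleton_iff]
    refine ⟨fun h => MFA.rho_injective ?_, fun h k => by rw [h]⟩
    ext i k
    exact congrFun (h k) i
  · rintro ⟨μ, hμ⟩
    rw [hcoset] at hμ ⊢
    exact hμ.isCompact hcl
  · rw [hcoset]
    exact MFA.exists_isUniformOn_of_isCompact
  · intro k
    rw [hJ]
    exact MFA.mem_iff_forall_col_eq Qhat k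
  · intro k hk
    ext i
    simp [hk]
  · intro k hk
    ext i
    simp [hk]
  · intro hF
    have hmean := MFA.mean_entry_of_finite (hcoset ▸ hF)
    ext i j
    rw [MFA.finFrameAverage, Matrix.smul_apply, Matrix.sum_apply,
      Finset.sum_congr rfl fun g hg => hentry Φ g (hF.mem_toFinset.1 hg) i j, Finset.sum_comm,
      smul_eq_mul, Finset.mul_sum, Matrix.mul_apply]
    refine Finset.sum_congr rfl fun k _ => ?_
    rw [Matrix.of_apply, ← hmean i k, ← Finset.sum_mul, mul_assoc]
    simp only [hcoset]
  · intro μ hμ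
    have hmeas : MeasurableSet (MFA.qrFrame η (MFA.phi sel P) Rhat) := by
      rw [hcoset]
      exact (MFA.isClosed_coset hcl Qhat).measurableSet
    have hμ' := hμ
    rw [hcoset] at hμ'
    have hint : ∀ i j k, IntegrableOn
        (fun g => MFA.rho g i k * Φ ((MFA.rho Qhat)⁻¹ * P) k j)
        (MFA.qrFrame η (MFA.phi sel P) Rhat) μ := by
      intro i j k
      rw [hcoset]
      exact (hμ'.integrableOn_entry i k).mul_const _
    refine ⟨fun i j => ?_, ?_⟩
    · refine IntegrableOn.congr_fun (integrable_finsetSum _ fun k _ => hint i j k)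
        (fun g hg => (hentry Φ g hg i j).symm) hmeas
    · ext i j
      rw [MFA.frameAverage, Matrix.of_apply,
        setIntegral_congr_fun hmeas fun g hg => hentry Φ g hg i j,
        integral_finsetSum _ fun k _ => hint i j k, Matrix.mul_apply]
      refine Finset.sum_congr rfl fun k _ => ?_
      rw [integral_mul_const, hcoset, hμ'.mean_entry i k, Matrix.of_apply]
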